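/- Let $G$ be a finite connected simple graph with edges $e_1,\dots,e_m$, and let $$P(G)=\Big\{f:E(G)\to\mathbb R_{\ge 0}\ :\ \sum_{e\in E(G)}f(e)=m\Big\}$$ be the simplex of edge weightings of $G$. Its interior consists of the $f\in P(G)$ with $f(e)>0$ for every edge $e$. For edge weights $x=(x_1,\dots,x_m)$ let $$\tau(x)=\sum_{T}\ \prod_{e_j\in T}x_j,\qquad \tau_j(x)=\frac{\partial\tau}{\partial x_j}(x),$$ where $T$ runs over the spanning trees of $G$. The effective resistance of the edge $e_j$ in the weighting $x$ is $\tau_j(x)/\tau(x)$, which is defined when $\tau(x)\neq 0$. (a) If $f$ is in the interior of $P(G)$, then $f$ maximizes $\tau$ on $P(G)$ if and only if all edges have the same effective resistance in the weighting $f$; this is also equivalent to $f$ maximizing $\tau$ on the interior of $P(G)$. (b) If $f\in P(G)$ is any weighting, possibly with some zero weights, such that $\tau(f)\ne 0$ and all edges of $G$ have the same effective resistance in the weighting $f$, then $f$ maximizes $\tau$ on $P(G)$. (c) For the constant weighting $f\equiv 1$, all edges have the same effective resistance if and only if $G$ is equiarboreal, that is, every edge of $G$ lies in the same number of spanning trees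 of $G$. Hence $f\equiv 1$ maximizes $\tau$ on $P(G)$ if and only if $G$ is equiarboreal. -/

import Mathlib

namespace WeightedTrees

variable {V : Type*} [Fintype V] [DecidableEq V] (G : SimpleGraph V) [DecidableRel G.Adj]

/-- The space `P(G)` of edge weightings: nonnegative real functions on the edges of `G` whose
total weight is the number of edges. It is a closed simplex. -/
def weightings : Set (G.edgeSet → ℝ) :=
  {f | (∀ e, 0 ≤ f e) ∧ ∑ e, f e = Fintype.card G.edgeSet}

/-- The interior of `P(G)`: the weightings for which no edge weight vanishes. -/
def positiveWeightings : Set (G.edgeSet → ℝ) :=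
  {f | (∀ e, 0 < f e) ∧ ∑ e, f e = Fintype.card G.edgeSet}

open Classical in
/-- The spanning trees of `G`, as sets of edges: the sets `T` of edges of `G` such that the graph
on all the vertices of `G` with edge set `T` is a tree. -/
noncomputable def spanningTrees : Finset (Finset G.edgeSet) :=
  Finset.univ.filter fun T =>
    (SimpleGraph.fromEdgeSet (Subtype.val '' (T : Set G.edgeSet))).IsTree

/-- The weighted tree number `τ(G)`, as a function of the edge weights. -/
noncomputable def treeNumber (x : G.edgeSet → ℝ) : ℝ :=
  ∑ T ∈ spanningTrees G, ∏ e ∈ T, x e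

/-- The partial derivative `τ_j` of the weighted tree number in the weight of the edge `e`. -/
noncomputable def treeNumberPartial (x : G.edgeSet → ℝ) (e : G.edgeSet) : ℝ :=
  lineDeriv ℝ (treeNumber G) x (Pi.single e 1)

/-- The effective resistance `τ_j / τ` of the edge `e`. -/
noncomputable def effectiveResistance (x : G.edgeSet → ℝ) (e : G.edgeSet) : ℝ :=
  treeNumberPartial G x e / treeNumber G x

/-- A graph is equiarboreal if each of its edges lies in the same number of spanning trees. -/
def Equiarboreal : Prop :=
  ∀ e e' : G.edgeSet,
    ((spanningTrees G).filter fun T => e ∈ T).card =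
      ((spanningTrees G).filter fun T => e' ∈ T).card

end WeightedTrees

/-!
By the weighted matrix-tree theorem `τ x = det L x`, where the reduced Laplacian `L x` is linear in
the edge weights, so Jacobi's formula gives `∑ e, y e * r e = tr ((L x)⁻¹ * L y)` for the effective
resistances `r` in the weighting `x`. For nonnegative `f` and `g` with `τ f ≠ 0`, applying
`λ ≤ exp (λ - 1)` to the eigenvalues of `(L f)⁻¹ * L g` yields
`τ g ≤ τ f * exp (∑ e, (g e - f e) * r e)`, which says that `log τ` lies below its tangent plane
at `f`. If `r` is constant, the exponent vanishes for all `f` and `g` of the same total weight, so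
`f` is maximal. Conversely, at an interior maximum the derivatives of `τ` in the directions that
move weight from one edge to another vanish, which forces `r` to be constant.
-/

namespace WeightedTrees

section Determinants

open Matrix

variable {m n E R : Type*} [Fintype m] [Fintype n] [DecidableEq n] [Fintype E] [CommRing R]

theorem det_mul_eq_sum_embedding (A : Matrix n E R) (B : Matrix E n R) :
    (A * B).det = ∑ p : n ↪ E, (∏ i, A i (p i)) * (B.submatrix p id).det := by
  classical
  have rows : A * B = fun i => ∑ e, A i e • B e := by
    ext i j
    simp [mul_apply]
  have expand : (A * B).det = ∑ p : n → E, (∏ i, A i (p i)) * (B.submatrix p id).det := by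
    rw [rows]
    change detRowAlternating.toMultilinearMap (fun i => ∑ e, A i e • B e) = _
    rw [MultilinearMap.map_sum]
    exact Finset.sum_congr rfl fun p _ => MultilinearMap.map_smul_univ _ _ _
  rw [expand]
  refine (Fintype.sum_of_injective _ DFunLike.coe_injective _ _ (fun p hp => ?_) fun _ => rfl).symm
  have not_injective : ¬ Function.Injective p := fun h => hp ⟨⟨p, h⟩, rfl⟩
  obtain ⟨i, j, heq, hne⟩ := Function.not_injective_iff.1 not_injective
  rw [det_zero_of_row_eq hne (congrArg B heq), mul_zero]

/-- The **Cauchy–Binet formula**. The product of the two minors on `S` is written as the determinant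
of a product, which spares choosing an identification of `S` with `n`. -/
theorem det_mul_eq_sum_det_submatrix (A : Matrix n E R) (B : Matrix E n R) :
    (A * B).det = ∑ S : Finset E with S.card = Fintype.card n,
      (A.submatrix id (Subtype.val : S → E) * B.submatrix (Subtype.val : S → E) id).det := by
  classical
  rw [det_mul_eq_sum_embedding, ← Finset.sum_fiberwise_of_maps_to
    (t := {S : Finset E | S.card = Fintype.card n}) (g := fun p : n ↪ E => Finset.univ.map p)
    fun p _ => by rw [Finset.mem_filter_univ, Finset.card_map, Finset.card_univ]]
  refine Finset.sum_congr rfl fun S hS => ?_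
  rw [Finset.mem_filter_univ] at hS
  rw [det_mul_eq_sum_embedding]
  symm
  refine Finset.sum_bij (fun q _ => q.trans (.subtype _)) (fun q _ => ?_)
    (fun q _ q' _ h => ?_) (fun p hp => ?_) fun q _ => rfl
  · refine Finset.mem_filter.2 ⟨Finset.mem_univ _, Finset.eq_of_subset_of_card_le ?_ ?_⟩
    · exact fun e he => by
        obtain ⟨i, -, rfl⟩ := Finset.mem_map.1 he
        exact (q i).2
    · rw [hS, Finset.card_map, Finset.card_univ]
  · ext i
    exact DFunLike.congr_fun h i
  · refine ⟨p.codRestrict S fun i => ?_, Finset.mem_univ _, rfl⟩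
    rw [Finset.mem_coe, ← (Finset.mem_filter.1 hp).2]
    exact Finset.mem_map_of_mem p (Finset.mem_univ i)

theorem det_mul_eq_det_submatrix_mul_det_submatrix (A : Matrix n m R) (B : Matrix m n R)
    (σ : n ≃ m) :
    (A * B).det = (A.submatrix id σ).det * (B.submatrix σ id).det := by
  rw [← det_mul, submatrix_mul_equiv, submatrix_id_id]

theorem det_mul_diagonal_mul_eq_sum_det_submatrix [DecidableEq E] (A : Matrix n E R) (x : E → R)
    (B : Matrix E n R) :
    (A * diagonal x * B).det = ∑ S : Finset E with S.card = Fintype.card n,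
      (∏ e ∈ S, x e) *
        (A.submatrix id (Subtype.val : S → E) * B.submatrix (Subtype.val : S → E) id).det := by
  rw [det_mul_eq_sum_det_submatrix]
  refine Finset.sum_congr rfl fun S hS => ?_
  rw [Finset.mem_filter_univ, ← Fintype.card_coe] at hS
  let σ : n ≃ S := Fintype.equivOfCardEq hS.symm
  have columns : ((A * diagonal x).submatrix id (Subtype.val : S → E)).submatrix id σ =
      of fun i j => x (σ j) * A.submatrix id (Subtype.val : S → E) i (σ j) := by
    ext i j
    simp [mul_comm]
  rw [det_mul_eq_det_submatrix_mul_det_submatrix _ _ σ, columns,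
    det_mul_eq_det_submatrix_mul_det_submatrix _ _ σ, ← mul_assoc, ← Finset.prod_coe_sort,
    ← σ.prod_comp, ← det_mul_row]
  rfl

/-- **Jacobi's formula** at an invertible matrix. -/
theorem hasDerivAt_det_add_smul {𝕜 : Type*} [NontriviallyNormedField 𝕜] (A C : Matrix n n 𝕜)
    (hA : A.det ≠ 0) :
    HasDerivAt (fun t : 𝕜 => (A + t • C).det) (A.det * (A⁻¹ * C).trace) 0 := by
  obtain ⟨p, hp⟩ : ∃ p : Polynomial 𝕜, ∀ t : 𝕜,
      (1 + t • (A⁻¹ * C)).det = 1 + (A⁻¹ * C).trace * t + p.eval t * t ^ 2 :=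
    ⟨_, fun t => det_one_add_smul t (A⁻¹ * C)⟩
  have factor (t : 𝕜) : (A + t • C).det =
      A.det * (1 + (A⁻¹ * C).trace * t + p.eval t * t ^ 2) := by
    rw [← hp, ← det_mul, Matrix.mul_add, Matrix.mul_one, Matrix.mul_smul,
      mul_nonsing_inv_cancel_left _ _ hA.isUnit]
  simp only [factor]
  have linear := ((hasDerivAt_id (0 : 𝕜)).const_mul (A⁻¹ * C).trace).const_add 1
  have quadratic := (p.hasDerivAt 0).mul (hasDerivAt_pow 2 (0 : 𝕜))
  simpa using (linear.add quadratic).const_mul A.det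

theorem det_le_exp_trace_sub_card {M : Matrix n n ℝ} (hM : M.PosSemidef) :
    M.det ≤ Real.exp (M.trace - Fintype.card n) := by
  let eig := hM.isHermitian.eigenvalues
  calc
    M.det = ∏ i, eig i := hM.isHermitian.det_eq_prod_eigenvalues
    _ ≤ ∏ i, Real.exp (eig i - 1) :=
      Finset.prod_le_prod (fun i _ => hM.eigenvalues_nonneg i) fun i _ => by
        simpa using Real.add_one_le_exp (eig i - 1)
    _ = Real.exp (∑ i, eig i - Fintype.card n) := by simp [← Real.exp_sum]
    _ = Real.exp (M.trace - Fintype.card n) := by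
      rw [hM.isHermitian.trace_eq_sum_eigenvalues]
      rfl

open scoped MatrixOrder in
theorem det_le_det_mul_exp {A C : Matrix n n ℝ} (hA : A.PosDef) (hC : C.PosSemidef) :
    C.det ≤ A.det * Real.exp ((A⁻¹ * C).trace - Fintype.card n) := by
  obtain ⟨S, hS⟩ := CStarAlgebra.nonneg_iff_eq_star_mul_self.mp hA.inv.posSemidef.nonneg
  rw [star_eq_conjTranspose] at hS
  have trace_eq : (S * C * Sᴴ).trace = (A⁻¹ * C).trace := by
    rw [trace_mul_comm, ← Matrix.mul_assoc, hS]
  have det_eq : (S * C * Sᴴ).det = A.det⁻¹ * C.det := by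
    rw [det_mul_right_comm, det_mul, det_mul, ← Ring.inverse_eq_inv', ← det_nonsing_inv, hS,
      det_mul, mul_comm S.det]
  rw [← inv_mul_le_iff₀ hA.det_pos, ← det_eq, ← trace_eq]
  exact det_le_exp_trace_sub_card (hC.mul_mul_conjTranspose_same S)

end Determinants

section MatrixTree

open Matrix SimpleGraph

/-- The signed incidence matrix of the multigraph on `V` with the edges `ends i`: the column of an
edge is `1` at its tail and `-1` at its head, where edges are oriented by `Quot.out`. Loops have
zero columns. -/
noncomputable def signedIncMatrix {V ι : Type*} [DecidableEq V] (R : Type*) [CommRing R]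
    (ends : ι → Sym2 V) : Matrix V ι R :=
  of fun v i => (Pi.single (Quot.out (ends i)).1 1 - Pi.single (Quot.out (ends i)).2 1 : V → R) v

/-- The signed incidence matrix with the row of the root `r` deleted. -/
noncomputable def reducedIncMatrix {V ι : Type*} [DecidableEq V] (R : Type*) [CommRing R]
    (ends : ι → Sym2 V) (r : V) : Matrix {v // v ≠ r} ι R :=
  (signedIncMatrix R ends).submatrix Subtype.val id

/-- The Laplacian of the multigraph with the edges `ends i` of weights `x i`, with the row and the
column of the root `r` deleted. -/
noncomputable def reducedLaplacian {V ι R : Type*} [DecidableEq V] [Fintype ι] [DecidableEq ι]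
    [CommRing R] (ends : ι → Sym2 V) (r : V) (x : ι → R) : Matrix {v // v ≠ r} {v // v ≠ r} R :=
  reducedIncMatrix R ends r * diagonal x * (reducedIncMatrix R ends r)ᵀ

variable {V ι R : Type*} [DecidableEq V] [CommRing R] {ends : ι → Sym2 V}

theorem exists_mulVec_signedIncMatrix_of_reachable [Fintype ι] {u v : V}
    (h : (fromEdgeSet (Set.range ends)).Reachable u v) :
    ∃ y, signedIncMatrix R ends *ᵥ y = Pi.single u 1 - Pi.single v 1 := by
  classical
  obtain ⟨p⟩ := h
  induction p with
  | nil => exact ⟨0, by rw [mulVec_zero, sub_self]⟩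
  | @cons a b c hab _ ih =>
    obtain ⟨y, hy⟩ := ih
    obtain ⟨i, hi⟩ := hab.1
    have column : signedIncMatrix R ends *ᵥ Pi.single i 1 =
        Pi.single (Quot.out (ends i)).1 1 - Pi.single (Quot.out (ends i)).2 1 :=
      mulVec_single_one _ i
    have orientation : s((Quot.out (ends i)).1, (Quot.out (ends i)).2) = s(a, b) :=
      (Quot.out_eq (ends i)).trans hi
    rcases Sym2.eq_iff.1 orientation with ⟨ha, hb⟩ | ⟨hb, ha⟩
    · exact ⟨Pi.single i 1 + y, by rw [mulVec_add, column, hy, ha, hb, sub_add_sub_cancel]⟩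
    · refine ⟨y - Pi.single i 1, ?_⟩
      rw [mulVec_sub, column, hy, ha, hb]
      abel

theorem vecMul_signedIncMatrix_apply [Fintype V] (c : V → R) (i : ι) :
    (c ᵥ* signedIncMatrix R ends) i = c (Quot.out (ends i)).1 - c (Quot.out (ends i)).2 := by
  change c ⬝ᵥ (Pi.single _ 1 - Pi.single _ 1) = _
  rw [dotProduct_sub, dotProduct_single_one, dotProduct_single_one]

theorem reducedLaplacian_add_smul [Fintype ι] [DecidableEq ι] (ends : ι → Sym2 V) (r : V)
    (x y : ι → R) (t : R) :
    reducedLaplacian ends r (x + t • y) =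
      reducedLaplacian ends r x + t • reducedLaplacian ends r y := by
  have diagonal_add_smul : diagonal (x + t • y) = diagonal x + t • diagonal y := by
    rw [← diagonal_smul, diagonal_add]
    rfl
  simp only [reducedLaplacian, diagonal_add_smul, Matrix.mul_add, Matrix.add_mul, Matrix.mul_smul,
    Matrix.smul_mul]

theorem posSemidef_reducedLaplacian [Finite V] [Fintype ι] [DecidableEq ι] (ends : ι → Sym2 V)
    (r : V) {x : ι → ℝ} (hx : ∀ i, 0 ≤ x i) : (reducedLaplacian ends r x).PosSemidef :=
  (PosSemidef.diagonal hx).mul_mul_conjTranspose_same _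

variable [Fintype V] {r : V}

theorem isUnit_det_reducedIncMatrix {ends : {v // v ≠ r} → Sym2 V}
    (h : (fromEdgeSet (Set.range ends)).Connected) : IsUnit (reducedIncMatrix R ends r).det := by
  -- A path from `v` to `r` gives the `v`-th column of the inverse, as the row of `r` is deleted.
  choose y hy using fun v : {v // v ≠ r} =>
    exists_mulVec_signedIncMatrix_of_reachable (R := R) (h v r)
  refine isUnit_det_of_right_inverse (B := of fun i v => y v i) ?_
  ext w v
  calc
    (reducedIncMatrix R ends r * of fun i v => y v i) w v =
        (signedIncMatrix R ends *ᵥ y v) w := rfl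
    _ = (1 : Matrix {v // v ≠ r} {v // v ≠ r} R) w v := by
      simp [hy, Pi.single_apply, one_apply, w.2, Subtype.ext_iff]

theorem det_reducedIncMatrix_eq_zero [IsDomain R] {ends : {v // v ≠ r} → Sym2 V}
    (h : ¬ (fromEdgeSet (Set.range ends)).Connected) : (reducedIncMatrix R ends r).det = 0 := by
  classical
  set H := fromEdgeSet (Set.range ends)
  obtain ⟨u, hu⟩ : ∃ u, ¬ H.Reachable r u := by
    by_contra! reachable
    exact h ((connected_iff _).2 ⟨fun a b => (reachable a).symm.trans (reachable b), ⟨r⟩⟩)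
  -- The indicator of the vertices not joined to `r` is a linear relation between the rows.
  let c : V → R := fun v => if H.Reachable r v then 0 else 1
  have c_root : c r = 0 := if_pos (Reachable.refl r)
  refine exists_vecMul_eq_zero_iff.1 ⟨fun v => c v, fun zero => ?_, ?_⟩
  · have hur : u ≠ r := fun eq => hu (eq ▸ Reachable.refl _)
    simpa [c, hu] using congrFun zero ⟨u, hur⟩
  · ext i
    have restrict : ((fun v : {v // v ≠ r} => c v) ᵥ* reducedIncMatrix R ends r) i =
        (c ᵥ* signedIncMatrix R ends) i := by
      refine Fintype.sum_of_injective _ Subtype.val_injective _ _ (fun v hv => ?_) fun _ => rfl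
      have : v = r := by simpa using hv
      rw [this, c_root, zero_mul]
    have reachable_iff :
        H.Reachable r (Quot.out (ends i)).1 ↔ H.Reachable r (Quot.out (ends i)).2 := by
      by_cases loop : (Quot.out (ends i)).1 = (Quot.out (ends i)).2
      · rw [loop]
      · have adj : H.Adj (Quot.out (ends i)).1 (Quot.out (ends i)).2 :=
          ⟨⟨i, (Quot.out_eq (ends i)).symm⟩, loop⟩
        exact ⟨fun h => h.trans adj.reachable, fun h => h.trans adj.symm.reachable⟩
    rw [restrict, vecMul_signedIncMatrix_apply]
    simp [c, reachable_iff]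

theorem det_reducedIncMatrix_sq (ends : {v // v ≠ r} → Sym2 V)
    [Decidable (fromEdgeSet (Set.range ends)).Connected] :
    (reducedIncMatrix R ends r).det ^ 2 =
      if (fromEdgeSet (Set.range ends)).Connected then 1 else 0 := by
  have over_int : (reducedIncMatrix ℤ ends r).det ^ 2 =
      if (fromEdgeSet (Set.range ends)).Connected then 1 else 0 := by
    split_ifs with h
    · exact Int.isUnit_sq (isUnit_det_reducedIncMatrix h)
    · rw [det_reducedIncMatrix_eq_zero h, zero_pow two_ne_zero]
  have cast_eq : reducedIncMatrix R ends r = (reducedIncMatrix ℤ ends r).map Int.cast := by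
    ext v i
    simp [reducedIncMatrix, signedIncMatrix, Pi.single_apply]
  rw [cast_eq, ← Int.cast_det, ← Int.cast_pow, over_int, Int.cast_ite, Int.cast_one, Int.cast_zero]

variable [Fintype ι]

theorem det_reducedIncMatrix_mul_transpose (ends : ι → Sym2 V)
    [Decidable (fromEdgeSet (Set.range ends)).Connected]
    (h : Fintype.card {v // v ≠ r} = Fintype.card ι) :
    (reducedIncMatrix R ends r * (reducedIncMatrix R ends r)ᵀ).det =
      if (fromEdgeSet (Set.range ends)).Connected then 1 else 0 := by
  classical
  let σ : {v // v ≠ r} ≃ ι := Fintype.equivOfCardEq h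
  rw [det_mul_eq_det_submatrix_mul_det_submatrix _ _ σ, ← transpose_submatrix, det_transpose, ← sq]
  have square := det_reducedIncMatrix_sq (R := R) (ends ∘ σ)
  simp only [σ.surjective.range_comp] at square
  exact square

open Classical in
/-- The weighted **matrix-tree theorem** for multigraphs. -/
theorem det_reducedLaplacian_eq_sum [DecidableEq ι] (ends : ι → Sym2 V) (r : V) (x : ι → R) :
    (reducedLaplacian ends r x).det = ∑ S : Finset ι with S.card = Fintype.card {v // v ≠ r},
      if (fromEdgeSet (ends '' S)).Connected then ∏ i ∈ S, x i else 0 := by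
  rw [reducedLaplacian, det_mul_diagonal_mul_eq_sum_det_submatrix]
  refine Finset.sum_congr rfl fun S hS => ?_
  rw [Finset.mem_filter_univ, ← Fintype.card_coe] at hS
  have minor := det_reducedIncMatrix_mul_transpose (R := R) (fun i : S => ends i) hS.symm
  simp only [Set.image_eq_range]
  exact (congrArg _ minor).trans (mul_boole _ _)

end MatrixTree

section TreeNumber

open Matrix SimpleGraph Topology

variable {V : Type*} [Fintype V] {G : SimpleGraph V}

theorem mem_spanningTrees_iff [DecidableRel G.Adj] {T : Finset G.edgeSet} :
    T ∈ spanningTrees G ↔ T.card + 1 = Fintype.card V ∧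
      (fromEdgeSet (Subtype.val '' (T : Set G.edgeSet))).Connected := by
  have edges : (fromEdgeSet (Subtype.val '' (T : Set G.edgeSet))).edgeSet =
      Subtype.val '' (T : Set G.edgeSet) := by
    rw [edgeSet_fromEdgeSet, sdiff_eq_left, ← Set.subset_compl_iff_disjoint_right]
    exact (Subtype.coe_image_subset _ _).trans G.edgeSet_subset_compl_diagSet
  classical
  rw [spanningTrees, Finset.mem_filter_univ, isTree_iff_connected_and_card, edges,
    Nat.card_image_of_injective Subtype.val_injective, Nat.card_coe_set_eq, Set.ncard_coe_finset,
    Nat.card_eq_fintype_card, and_comm]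

variable [DecidableRel G.Adj]

theorem spanningTrees_nonempty (hG : G.Connected) : (spanningTrees G).Nonempty := by
  classical
  obtain ⟨H, hle, hH⟩ := hG.exists_isTree_le
  let T : Finset G.edgeSet := {e | (e : Sym2 V) ∈ H.edgeSet}
  have edges : Subtype.val '' (T : Set G.edgeSet) = H.edgeSet := by
    ext e
    simpa [T] using fun he => edgeSet_mono hle he
  refine ⟨T, Finset.mem_filter.2 ⟨Finset.mem_univ T, ?_⟩⟩
  rwa [edges, fromEdgeSet_edgeSet]

theorem treeNumber_eq_det_reducedLaplacian [DecidableEq V] (r : V) (x : G.edgeSet → ℝ) :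
    treeNumber G x = (reducedLaplacian (Subtype.val : G.edgeSet → Sym2 V) r x).det := by
  classical
  rw [det_reducedLaplacian_eq_sum, ← Finset.sum_filter, Finset.filter_filter, treeNumber]
  refine Finset.sum_congr ?_ fun _ _ => rfl
  ext T
  have card_pos : 0 < Fintype.card V := Fintype.card_pos_iff.2 ⟨r⟩
  rw [mem_spanningTrees_iff, Finset.mem_filter_univ, Fintype.card_subtype_compl,
    Fintype.card_subtype_eq, eq_tsub_iff_add_eq_of_le card_pos]

theorem nonempty_of_treeNumber_ne_zero {x : G.edgeSet → ℝ} (hx : treeNumber G x ≠ 0) :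
    Nonempty V :=
  let ⟨_, hT, _⟩ := Finset.exists_ne_zero_of_sum_ne_zero hx
  (mem_spanningTrees_iff.1 hT).2.nonempty

theorem treeNumber_pos (hG : G.Connected) {x : G.edgeSet → ℝ} (hx : ∀ e, 0 < x e) :
    0 < treeNumber G x :=
  Finset.sum_pos (fun _ _ => Finset.prod_pos fun e _ => hx e) (spanningTrees_nonempty hG)

theorem positiveWeightings_subset_weightings : positiveWeightings G ⊆ weightings G :=
  fun _ hf => ⟨fun e => (hf.1 e).le, hf.2⟩

theorem eventually_add_smul_mem_positiveWeightings {f d : G.edgeSet → ℝ}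
    (hf : f ∈ positiveWeightings G) (hd : ∑ e, d e = 0) :
    ∀ᶠ t : ℝ in 𝓝 0, f + t • d ∈ positiveWeightings G := by
  have positive : ∀ᶠ t : ℝ in 𝓝 0, ∀ e, 0 < (f + t • d) e := by
    refine Filter.eventually_all.2 fun e => ?_
    have continuous : Continuous fun t : ℝ => (f + t • d) e := by
      simp only [Pi.add_apply, Pi.smul_apply]
      fun_prop
    exact continuous.continuousAt.eventually (lt_mem_nhds (by simpa using hf.1 e))
  filter_upwards [positive] with t ht
  exact ⟨ht, by simp [Finset.sum_add_distrib, ← Finset.mul_sum, hf.2, hd]⟩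

variable [DecidableEq V]

theorem hasFDerivAt_treeNumber (x : G.edgeSet → ℝ) :
    HasFDerivAt (treeNumber G)
      (∑ T ∈ spanningTrees G, ∑ e ∈ T,
        (∏ a ∈ T.erase e, x a) • ContinuousLinearMap.proj (R := ℝ) (φ := fun _ => ℝ) e) x :=
  HasFDerivAt.fun_sum fun _ _ => hasFDerivAt_finsetProd

theorem treeNumberPartial_eq_sum (x : G.edgeSet → ℝ) (e : G.edgeSet) :
    treeNumberPartial G x e = ∑ T ∈ spanningTrees G with e ∈ T, ∏ a ∈ T.erase e, x a := by
  rw [treeNumberPartial, ((hasFDerivAt_treeNumber x).hasLineDerivAt _).lineDeriv,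
    Finset.sum_filter]
  simp [Pi.single_apply]

theorem treeNumberPartial_one (e : G.edgeSet) :
    treeNumberPartial G (fun _ => 1) e = ((spanningTrees G).filter fun T => e ∈ T).card := by
  simp [treeNumberPartial_eq_sum]

theorem lineDeriv_treeNumber (x y : G.edgeSet → ℝ) :
    lineDeriv ℝ (treeNumber G) x y = ∑ e, y e * treeNumberPartial G x e := by
  have differentiable := (hasFDerivAt_treeNumber x).differentiableAt
  simp only [treeNumberPartial, differentiable.lineDeriv_eq_fderiv]
  conv_lhs => rw [← Finset.univ_sum_single y, map_sum]
  refine Finset.sum_congr rfl fun e _ => ?_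
  rw [← smul_eq_mul, ← map_smul, ← Pi.single_smul, smul_eq_mul, mul_one]

theorem sum_mul_effectiveResistance (r : V) {x : G.edgeSet → ℝ} (hx : treeNumber G x ≠ 0)
    (y : G.edgeSet → ℝ) :
    ∑ e, y e * effectiveResistance G x e =
      ((reducedLaplacian (Subtype.val : G.edgeSet → Sym2 V) r x)⁻¹ *
        reducedLaplacian (Subtype.val : G.edgeSet → Sym2 V) r y).trace := by
  have jacobi : HasLineDerivAt ℝ (treeNumber G) (treeNumber G x *
      ((reducedLaplacian (Subtype.val : G.edgeSet → Sym2 V) r x)⁻¹ *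
        reducedLaplacian (Subtype.val : G.edgeSet → Sym2 V) r y).trace) x y := by
    unfold HasLineDerivAt
    rw [treeNumber_eq_det_reducedLaplacian r] at hx
    simp only [treeNumber_eq_det_reducedLaplacian r, reducedLaplacian_add_smul]
    exact hasDerivAt_det_add_smul _ _ hx
  simp only [effectiveResistance, ← mul_div_assoc]
  rw [← Finset.sum_div, ← lineDeriv_treeNumber, jacobi.lineDeriv, mul_div_cancel_left₀ _ hx]

/-- **Foster's theorem** -/
theorem sum_mul_effectiveResistance_self (r : V) {x : G.edgeSet → ℝ} (hx : treeNumber G x ≠ 0) :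
    ∑ e, x e * effectiveResistance G x e = Fintype.card {v // v ≠ r} := by
  rw [sum_mul_effectiveResistance r hx, nonsing_inv_mul, trace_one]
  rw [← treeNumber_eq_det_reducedLaplacian]
  exact hx.isUnit

theorem treeNumber_le_mul_exp {f g : G.edgeSet → ℝ} (hf : ∀ e, 0 ≤ f e)
    (hg : ∀ e, 0 ≤ g e) (hτ : treeNumber G f ≠ 0) :
    treeNumber G g ≤
      treeNumber G f * Real.exp (∑ e, (g e - f e) * effectiveResistance G f e) := by
  obtain ⟨r⟩ := nonempty_of_treeNumber_ne_zero hτ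
  have posDef : (reducedLaplacian (Subtype.val : G.edgeSet → Sym2 V) r f).PosDef := by
    rwa [(posSemidef_reducedLaplacian _ r hf).posDef_iff_det_ne_zero,
      ← treeNumber_eq_det_reducedLaplacian]
  simp only [sub_mul, Finset.sum_sub_distrib, sum_mul_effectiveResistance_self r hτ,
    sum_mul_effectiveResistance r hτ g, treeNumber_eq_det_reducedLaplacian r]
  exact det_le_det_mul_exp posDef (posSemidef_reducedLaplacian _ r hg)

theorem isMaxOn_weightings_of_effectiveResistance_eq {f : G.edgeSet → ℝ}
    (hf : f ∈ weightings G) (hτ : treeNumber G f ≠ 0)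
    (h : ∀ e e', effectiveResistance G f e = effectiveResistance G f e') :
    IsMaxOn (treeNumber G) (weightings G) f := by
  intro g hg
  have exponent_eq_zero : ∑ e, (g e - f e) * effectiveResistance G f e = 0 := by
    rcases isEmpty_or_nonempty G.edgeSet with _ | ⟨⟨e₀⟩⟩
    · exact Finset.sum_of_isEmpty _
    · simp only [h _ e₀, ← Finset.sum_mul, Finset.sum_sub_distrib, hf.2, hg.2, sub_self, zero_mul]
  simpa [exponent_eq_zero] using treeNumber_le_mul_exp hf.1 hg.1 hτ

theorem effectiveResistance_eq_of_isMaxOn {f : G.edgeSet → ℝ} (hf : f ∈ positiveWeightings G)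
    (h : IsMaxOn (treeNumber G) (positiveWeightings G) f) (e e' : G.edgeSet) :
    effectiveResistance G f e = effectiveResistance G f e' := by
  have stationary : lineDeriv ℝ (treeNumber G) f (Pi.single e 1 - Pi.single e' 1) = 0 :=
    h.lineDeriv_eq_zero (eventually_add_smul_mem_positiveWeightings hf (by simp))
  have partials_eq : treeNumberPartial G f e - treeNumberPartial G f e' = 0 := by
    simpa [lineDeriv_treeNumber, sub_mul, Pi.single_apply] using stationary
  rw [effectiveResistance, effectiveResistance, sub_eq_zero.1 partials_eq]

theorem isMaxOn_weightings_iff (hG : G.Connected) {f : G.edgeSet → ℝ}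
    (hf : f ∈ positiveWeightings G) :
    IsMaxOn (treeNumber G) (weightings G) f ↔
      ∀ e e', effectiveResistance G f e = effectiveResistance G f e' :=
  ⟨fun h => effectiveResistance_eq_of_isMaxOn hf (h.on_subset positiveWeightings_subset_weightings),
    isMaxOn_weightings_of_effectiveResistance_eq (positiveWeightings_subset_weightings hf)
      (treeNumber_pos hG hf.1).ne'⟩

theorem isMaxOn_positiveWeightings_iff (hG : G.Connected) {f : G.edgeSet → ℝ}
    (hf : f ∈ positiveWeightings G) :
    IsMaxOn (treeNumber G) (positiveWeightings G) f ↔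
      ∀ e e', effectiveResistance G f e = effectiveResistance G f e' :=
  ⟨effectiveResistance_eq_of_isMaxOn hf, fun h =>
    ((isMaxOn_weightings_iff hG hf).2 h).on_subset positiveWeightings_subset_weightings⟩

theorem effectiveResistance_one_eq_iff_equiarboreal (hG : G.Connected) :
    (∀ e e' : G.edgeSet,
      effectiveResistance G (fun _ => 1) e = effectiveResistance G (fun _ => 1) e') ↔
      Equiarboreal G := by
  have ne_zero : treeNumber G (fun _ => 1) ≠ 0 := (treeNumber_pos hG fun _ => one_pos).ne'
  simp only [effectiveResistance, div_left_inj' ne_zero, treeNumberPartial_one, Nat.cast_inj,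
    Equiarboreal]

end TreeNumber

end WeightedTrees

open WeightedTrees in
theorem proposition1 {V : Type*} [Fintype V] [DecidableEq V] (G : SimpleGraph V)
    [DecidableRel G.Adj] (hG : G.Connected) :
    -- a weighting without vanishing weights is maximal, on the closed simplex as well as on
    -- its interior, if and only if all the effective resistances agree
    (∀ f ∈ positiveWeightings G,
      (IsMaxOn (treeNumber G) (weightings G) f ↔
        ∀ e e' : G.edgeSet, effectiveResistance G f e = effectiveResistance G f e') ∧
      (IsMaxOn (treeNumber G) (positiveWeightings G) f ↔
        ∀ e e' : G.edgeSet, effectiveResistance G f e = effectiveResistance G f e')) ∧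
    -- equal effective resistances suffice on the boundary too, where they are defined
    (∀ f ∈ weightings G, treeNumber G f ≠ 0 →
      (∀ e e' : G.edgeSet, effectiveResistance G f e = effectiveResistance G f e') →
        IsMaxOn (treeNumber G) (weightings G) f) ∧
    -- the unweighted case
    ((∀ e e' : G.edgeSet,
        effectiveResistance G (fun _ => 1) e = effectiveResistance G (fun _ => 1) e') ↔
      Equiarboreal G) ∧
    (IsMaxOn (treeNumber G) (weightings G) (fun _ => 1) ↔ Equiarboreal G) := by
  have unweighted := effectiveResistance_one_eq_iff_equiarboreal hG
  have one_mem : (fun _ => 1) ∈ positiveWeightings G := ⟨fun _ => one_pos, by simp⟩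
  exact ⟨fun f hf => ⟨isMaxOn_weightings_iff hG hf, isMaxOn_positiveWeightings_iff hG hf⟩,
    fun f hf hτ => isMaxOn_weightings_of_effectiveResistance_eq hf hτ, unweighted,
    (isMaxOn_weightings_iff hG one_mem).trans unweighted⟩
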